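/- Let $X$ be a reflexive complex Banach space with open unit ball $\mathbb{B}$, and let $L(X)$ denote the bounded linear operators on $X$. For $z\in X\setminus\{0\}$ let $T(z)$ be the set of continuous linear functionals $\ell_z:X\to\mathbb{C}$ with $\ell_z(z)=\|z\|$ and $\|\ell_z\|=1$, and for $A\in L(X)$ put $$m(A)=\inf\{\Re[\ell_z(A(z))]:\|z\|=1,\ \ell_z\in T(z)\},\qquad k(A)=\sup\{\Re[\ell_z(A(z))]:\|z\|=1,\ \ell_z\in T(z)\}.$$ A Schwarz mapping on $\mathbb{B}$ is a holomorphic mapping $w:\mathbb{B}\to\mathbb{B}$ with $w(0)=0$. Let $A\in L(X)$ be such that $m(A)>0$. For all $0\le s\le t<\infty$ let $v(\cdot,s,t)$ be a Schwarz mapping on $\mathbb{B}$, and assume that - $v(v(z,s,t),t,u)=v(z,s,u)$ for all $z\in\mathbb{B}$ and $0\le s\le t\le u<\infty$; - $v(z,s,t)\ne 0$ for all $z\in\mathbb{B}\setminus\{0\}$ and $0\le s\le t<\infty$; - $Dv(0,s,t)=e^{-(t-s)A}$ for all $t\ge s\ge 0$, where $D$ is the Fréchet derivative in $z$. Then, for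 all $z\in\mathbb{B}$ and $t\ge s\ge 0$, $$\frac{\|v(z,s,t)\|}{(1-\|v(z,s,t)\|)^2}\le e^{-m(A)(t-s)}\frac{\|z\|}{(1-\|z\|)^2}$$ and $$e^{-k(A)(t-s)}\frac{\|z\|}{(1+\|z\|)^2}\le\frac{\|v(z,s,t)\|}{(1+\|v(z,s,t)\|)^2}.$$ -/

import Mathlib

open Metric Set

namespace LoewnerBanach

variable {X : Type*} [NormedAddCommGroup X] [NormedSpace ℂ X]

/-- A complex normed space is reflexive if the canonical embedding into its bidual is onto. -/
def IsReflexiveSpace (X : Type*) [NormedAddCommGroup X] [NormedSpace ℂ X] : Prop :=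
  Function.Surjective (NormedSpace.inclusionInDoubleDual ℂ X)

/-- The set `T(z)` of support functionals at `z` (used for `z ≠ 0`). -/
def supportFunctionals (z : X) : Set (StrongDual ℂ X) :=
  {l | l z = (‖z‖ : ℂ) ∧ ‖l‖ = 1}

/-- The set of numbers `Re l(A z)` with `‖z‖ = 1` and `l ∈ T(z)`. It is bounded (by `‖A‖` in
absolute value), and it is nonempty as soon as `X` is nontrivial. -/
def reNumericalRange (A : X →L[ℂ] X) : Set ℝ :=
  {x | ∃ z : X, ‖z‖ = 1 ∧ ∃ l ∈ supportFunctionals z, x = (l (A z)).re}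

/-- `m(A)`, the infimum of the `Re l(A z)`. -/
noncomputable def lowerIndex (A : X →L[ℂ] X) : ℝ := sInf (reNumericalRange A)

/-- `k(A)`, the supremum of the `Re l(A z)`. -/
noncomputable def upperIndex (A : X →L[ℂ] X) : ℝ := sSup (reNumericalRange A)

/-- A Schwarz mapping: a holomorphic self-map of the open unit ball that fixes the origin.
Values outside the open unit ball are irrelevant. -/
structure IsSchwarzMapping (w : X → X) : Prop where
  holomorphic : DifferentiableOn ℂ w (ball 0 1)
  mapsTo : MapsTo w (ball 0 1) (ball 0 1)
  map_zero : w 0 = 0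

/-- The semigroup property `v(v(z,s,t),t,u) = v(z,s,u)` for `z` in the open unit ball and
`0 ≤ s ≤ t ≤ u`. -/
def SemigroupProperty (v : X → ℝ → ℝ → X) : Prop :=
  ∀ z ∈ ball (0 : X) 1, ∀ s t u : ℝ, 0 ≤ s → s ≤ t → t ≤ u → v (v z s t) t u = v z s u

end LoewnerBanach

open Filter Topology NormedSpace

namespace LoewnerBanach

/-! No differentiation in `t` is needed: the semigroup property cuts `[s, t]` into `n` steps of
length `h`. On one step, the Schwarz–Pick inequality for `ζ ↦ l (w (ζ u)) / ζ` bounds `‖w z‖`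
through `‖Dw(0) z‖` (`norm_mul_le`, `le_norm_mul`), and `Dw(0) = exp (-hA)` scales norms by a factor
between `exp (-kh)` and `exp (-mh)` (`exp_mul_norm_le_norm_exp`). Under the Koebe functions `r / (1
∓ r)²` each bound becomes multiplication by that exponential, up to an error `O(h²)` uniform on `‖y‖
≤ ‖z‖`. The `n` errors add up to `O(1/n)` and vanish in the limit (`SemigroupProperty.le_exp_mul`).
-/

/-- The **Schwarz–Pick inequality** at the origin, in terms of absolute values, for functions whose
value at the origin lies in the open unit disc. -/
theorem abs_norm_sub_norm_le_of_norm_zero_lt {g : ℂ → ℂ} (hd : DifferentiableOn ℂ g (ball 0 1))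
    (hg : ∀ ζ ∈ ball (0 : ℂ) 1, ‖g ζ‖ ≤ 1) (h0 : ‖g 0‖ < 1) {ζ : ℂ} (hζ : ζ ∈ ball (0 : ℂ) 1) :
    |‖g ζ‖ - ‖g 0‖| ≤ ‖ζ‖ * (1 - ‖g 0‖ * ‖g ζ‖) := by
  set a := g 0 with ha
  have key : ∀ w : ℂ, ‖w - a‖ ^ 2 = ‖w‖ ^ 2 + ‖a‖ ^ 2 - 2 * (star a * w).re := by
    intro w
    simp only [← Complex.normSq_eq_norm_sq, Complex.normSq_apply]
    simp
    ring
  have key' : ∀ w : ℂ,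
      ‖1 - star a * w‖ ^ 2 = 1 + ‖a‖ ^ 2 * ‖w‖ ^ 2 - 2 * (star a * w).re := by
    intro w
    simp only [← Complex.normSq_eq_norm_sq, Complex.normSq_apply]
    simp
    ring
  have hlt : ∀ w : ℂ, ‖w‖ ≤ 1 → ‖star a * w‖ < 1 := fun w hw => by
    rw [norm_mul, norm_star]
    nlinarith [norm_nonneg a, norm_nonneg w]
  have hne : ∀ w : ℂ, ‖w‖ ≤ 1 → 1 - star a * w ≠ 0 := fun w hw h => by
    have := hlt w hw
    rw [← sub_eq_zero.1 h] at this
    simp at this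
  -- Composing with the disc automorphism that sends `a` to `0` reduces the claim to the Schwarz
  -- lemma.
  have hmaps : MapsTo (fun ζ => (g ζ - a) / (1 - star a * g ζ)) (ball 0 1) (closedBall 0 1) := by
    intro ξ hξ
    rw [mem_closedBall_zero_iff, norm_div, div_le_one (norm_pos_iff.2 (hne _ (hg ξ hξ)))]
    refine le_of_sq_le_sq ?_ (norm_nonneg _)
    rw [key, key']
    have h1 : ‖a‖ ^ 2 ≤ 1 := by nlinarith [norm_nonneg a]
    have h2 : ‖g ξ‖ ^ 2 ≤ 1 := by nlinarith [norm_nonneg (g ξ), hg ξ hξ]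
    nlinarith
  have hdiff : DifferentiableOn ℂ (fun ζ => (g ζ - a) / (1 - star a * g ζ)) (ball 0 1) :=
    (hd.sub_const a).div ((hd.const_mul _).const_sub 1) fun ξ hξ => hne _ (hg ξ hξ)
  have hs := Complex.norm_le_norm_of_mapsTo_ball hdiff hmaps (by simp [ha])
    (mem_ball_zero_iff.1 hζ)
  rw [norm_div, div_le_iff₀ (norm_pos_iff.2 (hne _ (hg ζ hζ)))] at hs
  have hs2 : ‖g ζ - a‖ ^ 2 ≤ ‖ζ‖ ^ 2 * ‖1 - star a * g ζ‖ ^ 2 := by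
    rw [← mul_pow]; gcongr
  rw [key, key'] at hs2
  -- In `hs2` this real part has total coefficient `2 (1 - ‖ζ‖²) ≥ 0`, so its upper bound may
  -- replace it.
  have hre : (star a * g ζ).re ≤ ‖a‖ * ‖g ζ‖ := by
    simpa using Complex.re_le_norm (star a * g ζ)
  have hr : ‖ζ‖ ^ 2 ≤ 1 := by nlinarith [norm_nonneg ζ, mem_ball_zero_iff.1 hζ]
  have h1 : 0 ≤ 1 - ‖a‖ * ‖g ζ‖ := by
    have := hlt _ (hg ζ hζ)
    rw [norm_mul, norm_star] at this
    linarith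
  refine abs_le_of_sq_le_sq ?_ (mul_nonneg (norm_nonneg _) h1)
  nlinarith

/-- The **Schwarz–Pick inequality** at the origin, in terms of absolute values. -/
theorem abs_norm_sub_norm_le {g : ℂ → ℂ} (hd : DifferentiableOn ℂ g (ball 0 1))
    (hg : ∀ ζ ∈ ball (0 : ℂ) 1, ‖g ζ‖ ≤ 1) {ζ : ℂ} (hζ : ζ ∈ ball (0 : ℂ) 1) :
    |‖g ζ‖ - ‖g 0‖| ≤ ‖ζ‖ * (1 - ‖g 0‖ * ‖g ζ‖) := by
  -- Scaling by `c < 1` forces `‖c g(0)‖ < 1`; letting `c → 1` covers `‖g 0‖ = 1`.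
  have h : ∀ᶠ c : ℝ in 𝓝[<] 1,
      |c * ‖g ζ‖ - c * ‖g 0‖| ≤ ‖ζ‖ * (1 - (c * ‖g 0‖) * (c * ‖g ζ‖)) := by
    filter_upwards [Ioo_mem_nhdsLT (zero_lt_one (α := ℝ))] with c hc
    have hn : ∀ w : ℂ, ‖(c : ℂ) * w‖ = c * ‖w‖ := fun w => by
      rw [norm_mul, Complex.norm_real, Real.norm_of_nonneg hc.1.le]
    have h0 := hg 0 (by simp)
    have := abs_norm_sub_norm_le_of_norm_zero_lt (g := fun ζ => (c : ℂ) * g ζ) (hd.const_mul _)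
      (fun ξ hξ => by rw [hn]; nlinarith [hg ξ hξ, norm_nonneg (g ξ), hc.1, hc.2])
      (by rw [hn]; nlinarith [norm_nonneg (g 0), hc.1, hc.2]) hζ
    simpa only [hn] using this
  have hc : Tendsto (fun c : ℝ => c) (𝓝[<] 1) (𝓝 1) := tendsto_nhdsWithin_of_tendsto_nhds tendsto_id
  have hl : Tendsto (fun c : ℝ => |c * ‖g ζ‖ - c * ‖g 0‖|) (𝓝[<] 1) (𝓝 |1 * ‖g ζ‖ - 1 * ‖g 0‖|) :=
    ((hc.mul_const _).sub (hc.mul_const _)).abs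
  have hr : Tendsto (fun c : ℝ => ‖ζ‖ * (1 - (c * ‖g 0‖) * (c * ‖g ζ‖))) (𝓝[<] 1)
      (𝓝 (‖ζ‖ * (1 - (1 * ‖g 0‖) * (1 * ‖g ζ‖)))) :=
    (((hc.mul_const _).mul (hc.mul_const _)).const_sub _).const_mul _
  simpa using le_of_tendsto_of_tendsto hl hr h

/-! ### Schwarz mappings on complex lines. -/

variable {X : Type*} [NormedAddCommGroup X] [NormedSpace ℂ X]

theorem IsSchwarzMapping.norm_le {w : X → X} (hw : IsSchwarzMapping w) {z : X}
    (hz : z ∈ ball (0 : X) 1) : ‖w z‖ ≤ ‖z‖ :=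
  Complex.norm_le_norm_of_mapsTo_ball hw.holomorphic
    (fun _ hy => ball_subset_closedBall (hw.mapsTo hy)) hw.map_zero (mem_ball_zero_iff.1 hz)

/-- The Schwarz–Pick inequality for the restriction of `l ∘ w` to the complex line through `z`. -/
theorem IsSchwarzMapping.abs_sub_le {w : X → X} (hw : IsSchwarzMapping w) {z : X}
    (hz : z ∈ ball (0 : X) 1) (hz0 : z ≠ 0) (l : StrongDual ℂ X) (hl : ‖l‖ ≤ 1) :
    ‖l (fderiv ℂ w 0 z)‖ / ‖z‖ ≤ 1 ∧
    |‖l (w z)‖ / ‖z‖ - ‖l (fderiv ℂ w 0 z)‖ / ‖z‖| ≤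
      ‖z‖ * (1 - ‖l (fderiv ℂ w 0 z)‖ / ‖z‖ * (‖l (w z)‖ / ‖z‖)) := by
  have hr : 0 < ‖z‖ := norm_pos_iff.2 hz0
  have hrne : (‖z‖ : ℂ) ≠ 0 := by exact_mod_cast hr.ne'
  set u : X := (‖z‖ : ℂ)⁻¹ • z with hu
  have hun : ‖u‖ = 1 := by rw [hu, norm_smul]; simp [hr.ne']
  have hzu : (‖z‖ : ℂ) • u = z := by rw [hu, smul_smul, mul_inv_cancel₀ hrne, one_smul]
  set f : ℂ → ℂ := fun ζ => l (w (ζ • u)) with hf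
  have hball : MapsTo (fun ζ : ℂ => ζ • u) (ball 0 1) (ball 0 1) := fun ζ hζ => by
    simpa [norm_smul, hun] using hζ
  have hfd : DifferentiableOn ℂ f (ball 0 1) :=
    l.differentiable.comp_differentiableOn
      (hw.holomorphic.comp (by fun_prop : Differentiable ℂ fun ζ : ℂ => ζ • u).differentiableOn
        hball)
  have hf0 : f 0 = 0 := by simp [hf, hw.map_zero]
  have hfm : MapsTo f (ball 0 1) (closedBall (f 0) 1) := fun ζ hζ => by
    rw [hf0, mem_closedBall_zero_iff]
    have h1 : ‖w (ζ • u)‖ < 1 := mem_ball_zero_iff.1 (hw.mapsTo (hball hζ))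
    calc ‖l (w (ζ • u))‖ ≤ ‖l‖ * ‖w (ζ • u)‖ := l.le_opNorm _
      _ ≤ 1 * 1 := by gcongr
      _ = 1 := one_mul 1
  have hg : ∀ ζ ∈ ball (0 : ℂ) 1, ‖dslope f 0 ζ‖ ≤ 1 := fun ζ hζ => by
    simpa using Complex.norm_dslope_le_div_of_mapsTo_ball hfd hfm hζ
  have hgd : DifferentiableOn ℂ (dslope f 0) (ball 0 1) :=
    (Complex.differentiableOn_dslope (ball_mem_nhds 0 one_pos)).2 hfd
  have hw0 : HasFDerivAt w (fderiv ℂ w 0) ((0 : ℂ) • u) := by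
    rw [zero_smul]
    exact (hw.holomorphic.differentiableAt (ball_mem_nhds 0 one_pos)).hasFDerivAt
  have hder : HasDerivAt f (l (fderiv ℂ w 0 u)) 0 := by
    have h1 : HasDerivAt (fun ζ : ℂ => ζ • u) u 0 := by
      simpa using (hasDerivAt_id (0 : ℂ)).smul_const u
    exact l.hasFDerivAt.comp_hasDerivAt (0 : ℂ) (hw0.comp_hasDerivAt (0 : ℂ) h1)
  have e0 : ‖dslope f 0 0‖ = ‖l (fderiv ℂ w 0 z)‖ / ‖z‖ := by
    rw [dslope_same, hder.deriv, hu]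
    simp [div_eq_inv_mul]
  have er : ‖dslope f 0 (‖z‖ : ℂ)‖ = ‖l (w z)‖ / ‖z‖ := by
    rw [dslope_of_ne _ hrne, slope_def_field, hf0]
    simp [hf, hzu]
  have hzb : (‖z‖ : ℂ) ∈ ball (0 : ℂ) 1 := by simpa using hz
  have h := abs_norm_sub_norm_le hgd hg hzb
  rw [e0, er, Complex.norm_real, norm_norm] at h
  exact ⟨e0 ▸ hg 0 (by simp), h⟩

/-- Take `l` norming `w z`; the Schwarz–Pick bound `(c + r) / (1 + c r)` increases with `c`, so `c`
may be raised to `q`. -/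
theorem IsSchwarzMapping.norm_mul_le {w : X → X} (hw : IsSchwarzMapping w) {z : X}
    (hz : z ∈ ball (0 : X) 1) (hz0 : z ≠ 0) {q : ℝ} (hq : ‖fderiv ℂ w 0 z‖ ≤ q * ‖z‖) :
    ‖w z‖ * (1 + q * ‖z‖) ≤ ‖z‖ * (q + ‖z‖) := by
  have hr : 0 < ‖z‖ := norm_pos_iff.2 hz0
  have hr1 : ‖z‖ < 1 := mem_ball_zero_iff.1 hz
  obtain ⟨l, hl, hlw⟩ := exists_dual_vector'' ℂ (w z)
  obtain ⟨-, h⟩ := hw.abs_sub_le hz hz0 l hl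
  have hx : ‖l (w z)‖ = ‖w z‖ := by rw [hlw]; simp
  rw [hx] at h
  set c := ‖l (fderiv ℂ w 0 z)‖ / ‖z‖ with hc
  set x := ‖w z‖ / ‖z‖ with hxdef
  have hcq : c ≤ q := by
    rw [hc, div_le_iff₀ hr]
    calc ‖l (fderiv ℂ w 0 z)‖ ≤ ‖l‖ * ‖fderiv ℂ w 0 z‖ := l.le_opNorm _
      _ ≤ 1 * (q * ‖z‖) := by gcongr
      _ = _ := one_mul _
  have hx1 : x ≤ 1 := (div_le_one hr).2 (hw.norm_le hz)
  have hxr : ‖w z‖ = ‖z‖ * x := by rw [hxdef]; field_simp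
  have hx0 : 0 ≤ x := by positivity
  have h1 := (abs_le.1 h).2
  have h2 : x * (1 + q * ‖z‖) ≤ q + ‖z‖ := by
    nlinarith [mul_nonneg (sub_nonneg.2 hcq) (by nlinarith : 0 ≤ 1 - x * ‖z‖)]
  rw [hxr, mul_assoc]
  exact mul_le_mul_of_nonneg_left h2 hr.le

/-- Here `l` norms the derivative `Dw(0) z` instead, so that no size is lost at the origin. -/
theorem IsSchwarzMapping.le_norm_mul {w : X → X} (hw : IsSchwarzMapping w) {z : X}
    (hz : z ∈ ball (0 : X) 1) (hz0 : z ≠ 0) {p : ℝ} (hp : p * ‖z‖ ≤ ‖fderiv ℂ w 0 z‖) :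
    ‖z‖ * (p - ‖z‖) ≤ ‖w z‖ * (1 - p * ‖z‖) := by
  have hr : 0 < ‖z‖ := norm_pos_iff.2 hz0
  have hr1 : ‖z‖ < 1 := mem_ball_zero_iff.1 hz
  obtain ⟨l, hl, hlw⟩ := exists_dual_vector'' ℂ (fderiv ℂ w 0 z)
  obtain ⟨hc1, h⟩ := hw.abs_sub_le hz hz0 l hl
  have hx : ‖l (fderiv ℂ w 0 z)‖ = ‖fderiv ℂ w 0 z‖ := by rw [hlw]; simp
  rw [hx] at h hc1
  set c := ‖fderiv ℂ w 0 z‖ / ‖z‖ with hc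
  set x := ‖w z‖ / ‖z‖ with hxdef
  have hyx : ‖l (w z)‖ / ‖z‖ ≤ x := by
    rw [hxdef]
    gcongr
    calc ‖l (w z)‖ ≤ ‖l‖ * ‖w z‖ := l.le_opNorm _
      _ ≤ 1 * ‖w z‖ := by gcongr
      _ = _ := one_mul _
  set y := ‖l (w z)‖ / ‖z‖
  have hcp : p ≤ c := (le_div_iff₀ hr).2 hp
  have hxr : ‖w z‖ = ‖z‖ * x := by rw [hxdef]; field_simp
  have hx0 : 0 ≤ x := by positivity
  have h1 := (abs_le.1 h).1
  have h2 : p - ‖z‖ ≤ x * (1 - p * ‖z‖) := by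
    nlinarith [mul_nonneg (sub_nonneg.2 hcp) (by positivity : 0 ≤ x * ‖z‖),
      mul_nonneg (sub_nonneg.2 hyx) (by nlinarith : 0 ≤ 1 - c * ‖z‖)]
  rw [hxr, mul_assoc]
  exact mul_le_mul_of_nonneg_left h2 hr.le

/-! ### Koebe functions under one step. -/

/-- One step of the upper estimate for the Koebe function. -/
theorem div_one_sub_sq_le {r ρ q : ℝ} (hr0 : 0 ≤ r) (hr1 : r < 1) (hq0 : 0 ≤ q)
    (hρ0 : 0 ≤ ρ) (hρ1 : ρ < 1) (h : ρ * (1 + q * r) ≤ r * (q + r)) :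
    ρ / (1 - ρ) ^ 2 ≤ q * (r / (1 - r) ^ 2) + (r * (1 - q)) ^ 2 / (1 - r ^ 2) ^ 2 := by
  have hD : 0 < 1 + q * r := by positivity
  have h1r : 0 < 1 - r := by linarith
  have h1r2 : 0 < 1 - r ^ 2 := by nlinarith
  have hle : (1 - r ^ 2) ≤ (1 - ρ) * (1 + q * r) := by nlinarith
  -- The right side is exactly `σ / (1 - σ)²` at `σ = r (q + r) / (1 + q r)`, because `1 - σ = (1 -
  -- r²) / (1 + q r)`.
  have e : q * (r / (1 - r) ^ 2) + (r * (1 - q)) ^ 2 / (1 - r ^ 2) ^ 2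
      = r * (q + r) * (1 + q * r) / (1 - r ^ 2) ^ 2 := by
    have : (1 - r ^ 2) = (1 - r) * (1 + r) := by ring
    rw [this]
    have : (1 + r) ≠ 0 := by positivity
    field_simp
    ring
  rw [e, div_le_div_iff₀ (by have : 0 < 1 - ρ := by linarith
                             positivity) (by positivity)]
  calc ρ * (1 - r ^ 2) ^ 2 ≤ ρ * ((1 - ρ) * (1 + q * r)) ^ 2 := by gcongr
    _ = (ρ * (1 + q * r)) * ((1 + q * r) * (1 - ρ) ^ 2) := by ring
    _ ≤ (r * (q + r)) * ((1 + q * r) * (1 - ρ) ^ 2) := by gcongr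
    _ = _ := by ring

/-- One step of the lower estimate for the Koebe function. -/
theorem le_div_one_add_sq {r ρ p : ℝ} (hr0 : 0 ≤ r) (hr1 : r < 1) (hp1 : p ≤ 1)
    (hρ0 : 0 ≤ ρ) (hρ1 : ρ < 1) (h : r * (p - r) ≤ ρ * (1 - p * r)) :
    p * (r / (1 + r) ^ 2) - (r * (1 - p)) ^ 2 / (1 - r ^ 2) ^ 2 ≤ ρ / (1 + ρ) ^ 2 := by
  have hD : 0 < 1 - p * r := by nlinarith
  have h1r : 0 < 1 - r := by linarith
  have h1r2 : 0 < 1 - r ^ 2 := by nlinarith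
  have e : p * (r / (1 + r) ^ 2) - (r * (1 - p)) ^ 2 / (1 - r ^ 2) ^ 2
      = r * (p - r) * (1 - p * r) / (1 - r ^ 2) ^ 2 := by
    have : (1 - r ^ 2) = (1 - r) * (1 + r) := by ring
    rw [this]
    have : (1 + r) ≠ 0 := by positivity
    field_simp
    ring
  rw [e, div_le_div_iff₀ (by positivity) (by positivity)]
  -- with `σ = r (p - r) / (1 - p r)`, the difference is a multiple of `(ρ - σ) (1 - ρ σ)`
  have h2 : 0 ≤ (1 - p * r) - ρ * (r * (p - r)) := by
    have : r * (p - r) ≤ 1 - p * r := by nlinarith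
    nlinarith
  nlinarith [mul_nonneg (sub_nonneg.2 h) h2]

/-! ### Numerical range and growth of the exponential. -/

/-- If `Re l(B u) ≥ a` for all unit vectors `u` and support functionals `l` at `u`, then `exp B`
expands norms by at least `exp a`. -/
theorem exp_mul_norm_le_norm_exp [CompleteSpace X] (B : X →L[ℂ] X) (a : ℝ)
    (hB : ∀ u : X, ‖u‖ = 1 → ∀ l ∈ supportFunctionals u, a ≤ (l (B u)).re) (x : X) :
    Real.exp a * ‖x‖ ≤ ‖NormedSpace.exp B x‖ := by
  -- First-order remainder of `exp (B/n)`, which is `o(1/n)`. Each factor `exp (B/n)` expands by at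
  -- least `1 + a/n - ε n`, and the `n`-th power of this tends to `exp a`.
  set ε : ℕ → ℝ := fun n =>
    ‖NormedSpace.exp (((n : ℂ)⁻¹) • B) - 1 - ((n : ℂ)⁻¹) • B‖ with hε
  have hunit : ∀ n : ℕ, ∀ u : X, ‖u‖ = 1 →
      1 + (a / n - ε n) ≤ ‖NormedSpace.exp (((n : ℂ)⁻¹) • B) u‖ := by
    intro n u hu
    obtain ⟨l, hl, hlu⟩ := exists_dual_vector ℂ u (by simp [hu])
    have h1 := hB u hu l ⟨hlu, hl⟩
    set R := NormedSpace.exp (((n : ℂ)⁻¹) • B) - 1 - ((n : ℂ)⁻¹) • B with hR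
    have hsum : NormedSpace.exp (((n : ℂ)⁻¹) • B) u = u + ((n : ℂ)⁻¹) • B u + R u := by
      simp [hR]
    have hre : (l (NormedSpace.exp (((n : ℂ)⁻¹) • B) u)).re
        = 1 + (l (B u)).re / n + (l (R u)).re := by
      rw [hsum, map_add, map_add, map_smul, hlu, hu]
      have : ((n : ℂ)⁻¹) = (((n : ℝ)⁻¹ : ℝ) : ℂ) := by push_cast; rfl
      rw [this, smul_eq_mul, Complex.add_re, Complex.add_re, Complex.re_ofReal_mul]
      simp [div_eq_inv_mul]
    have hRu : ‖l (R u)‖ ≤ ε n := by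
      calc ‖l (R u)‖ ≤ ‖l‖ * ‖R u‖ := l.le_opNorm _
        _ ≤ 1 * (‖R‖ * ‖u‖) := by rw [hl]; gcongr; exact R.le_opNorm _
        _ = ε n := by rw [hu]; simp [hε, hR]
    have h2 := (abs_le.1 ((Complex.abs_re_le_norm (l (R u))).trans hRu)).1
    have h3 : (l (NormedSpace.exp (((n : ℂ)⁻¹) • B) u)).re
        ≤ ‖NormedSpace.exp (((n : ℂ)⁻¹) • B) u‖ := by
      refine (Complex.re_le_norm _).trans ((l.le_opNorm _).trans ?_)
      rw [hl, one_mul]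
    have h4 : a / n ≤ (l (B u)).re / n := by gcongr
    linarith
  have hstep : ∀ n : ℕ, ∀ y : X,
      (1 + (a / n - ε n)) * ‖y‖ ≤ ‖NormedSpace.exp (((n : ℂ)⁻¹) • B) y‖ := by
    intro n y
    rcases eq_or_ne y 0 with rfl | hy
    · simp
    have hy' : 0 < ‖y‖ := norm_pos_iff.2 hy
    have := hunit n (((‖y‖ : ℂ)⁻¹) • y) (by rw [norm_smul]; simp [hy'.ne'])
    rw [map_smul, norm_smul, norm_inv, Complex.norm_real, norm_norm, ← div_eq_inv_mul,
      le_div_iff₀ hy'] at this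
    exact this
  have hlim : Tendsto (fun n : ℕ => (n : ℝ) * ε n) atTop (𝓝 0) := by
    have ho := (hasFDerivAt_exp_zero (𝕂 := ℂ) (𝔸 := X →L[ℂ] X)).isLittleO
    have ht : Tendsto (fun n : ℕ => ((n : ℂ)⁻¹) • B) atTop (𝓝 0) := by
      have : Tendsto (fun n : ℕ => ((n : ℂ)⁻¹)) atTop (𝓝 0) :=
        tendsto_inv_atTop_nhds_zero_nat (𝕜 := ℂ)
      simpa using this.smul_const B
    have ho2 := ho.comp_tendsto ht
    have hO : (fun n : ℕ => ((n : ℂ)⁻¹) • B) =O[atTop] fun n : ℕ => ((n : ℝ)⁻¹) := by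
      refine Asymptotics.IsBigO.of_bound ‖B‖ (Eventually.of_forall fun n => ?_)
      rw [norm_smul]
      simp [mul_comm]
    have ho3 : (fun n : ℕ => ε n) =o[atTop] fun n : ℕ => ((n : ℝ)⁻¹) := by
      have h5 := (ho2.trans_isBigO (by simpa [Function.comp_def] using hO)).norm_left
      refine h5.congr_left fun n => ?_
      simp [hε]
    have := ho3.tendsto_div_nhds_zero
    refine this.congr fun n => ?_
    rw [div_inv_eq_mul, mul_comm]
  have hlim2 : Tendsto (fun n : ℕ => (n : ℝ) * (a / n - ε n)) atTop (𝓝 a) := by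
    have h1 : Tendsto (fun n : ℕ => a - (n : ℝ) * ε n) atTop (𝓝 (a - 0)) := hlim.const_sub a
    rw [sub_zero] at h1
    refine h1.congr' ?_
    filter_upwards [eventually_gt_atTop 0] with n hn
    have : (n : ℝ) ≠ 0 := by positivity
    field_simp
  have hpow := Real.tendsto_one_add_pow_exp_of_tendsto hlim2
  -- Iterating the lower bound requires a nonnegative factor.
  have hnn : ∀ᶠ n : ℕ in atTop, 0 ≤ 1 + (a / n - ε n) := by
    have h1 : Tendsto (fun n : ℕ => (n : ℝ)⁻¹ * ((n : ℝ) * (a / n - ε n))) atTop (𝓝 (0 * a)) :=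
      (tendsto_inv_atTop_nhds_zero_nat (𝕜 := ℝ)).mul hlim2
    rw [zero_mul] at h1
    filter_upwards [h1.eventually (lt_mem_nhds (by norm_num : (-1 : ℝ) < 0)),
      eventually_gt_atTop 0] with n hn hn0
    have : (n : ℝ) ≠ 0 := by positivity
    rw [inv_mul_cancel_left₀ this] at hn
    linarith
  refine le_of_tendsto (hpow.mul_const ‖x‖) ?_
  filter_upwards [hnn, eventually_gt_atTop 0] with n hn hn0
  have hexp : NormedSpace.exp B = NormedSpace.exp (((n : ℂ)⁻¹) • B) ^ n := by
    let _ : NormedAlgebra ℚ (X →L[ℂ] X) := .restrictScalars ℚ ℂ _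
    rw [← NormedSpace.exp_nsmul, ← Nat.cast_smul_eq_nsmul ℂ, smul_smul, mul_inv_cancel₀,
      one_smul]
    exact_mod_cast hn0.ne'
  have hiter : ∀ k : ℕ, (1 + (a / n - ε n)) ^ k * ‖x‖
      ≤ ‖(NormedSpace.exp (((n : ℂ)⁻¹) • B) ^ k) x‖ := by
    intro k
    induction k with
    | zero => simp
    | succ k ih =>
      rw [pow_succ', pow_succ', mul_apply_eq_comp, mul_assoc]
      exact (mul_le_mul_of_nonneg_left ih hn).trans (hstep n _)
  rw [hexp]
  exact hiter n

theorem abs_le_of_mem_reNumericalRange {A : X →L[ℂ] X} {x : ℝ} (hx : x ∈ reNumericalRange A) :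
    |x| ≤ ‖A‖ := by
  obtain ⟨u, hu, l, ⟨-, hl⟩, rfl⟩ := hx
  refine (Complex.abs_re_le_norm _).trans ((l.le_opNorm _).trans ?_)
  simpa [hl, hu] using A.le_opNorm u

theorem lowerIndex_le {A : X →L[ℂ] X} {x : ℝ} (hx : x ∈ reNumericalRange A) :
    lowerIndex A ≤ x :=
  csInf_le ⟨-‖A‖, fun _ hy => (abs_le.1 (abs_le_of_mem_reNumericalRange hy)).1⟩ hx

theorem le_upperIndex {A : X →L[ℂ] X} {x : ℝ} (hx : x ∈ reNumericalRange A) :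
    x ≤ upperIndex A :=
  le_csSup ⟨‖A‖, fun _ hy => (abs_le.1 (abs_le_of_mem_reNumericalRange hy)).2⟩ hx

theorem reNumericalRange_nonempty [Nontrivial X] (A : X →L[ℂ] X) :
    (reNumericalRange A).Nonempty := by
  obtain ⟨u, hu⟩ := exists_norm_eq X zero_le_one
  obtain ⟨l, hl, hlu⟩ := exists_dual_vector ℂ u (by simp [hu])
  exact ⟨_, u, hu, l, ⟨hlu, hl⟩, rfl⟩

/-- The inverse `exp (hA)` expands norms by at least `exp (mh)`. -/
theorem norm_exp_neg_smul_le [CompleteSpace X] (A : X →L[ℂ] X) {h : ℝ} (hh : 0 ≤ h) (x : X) :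
    ‖NormedSpace.exp (((-h : ℝ) : ℂ) • A) x‖ ≤ Real.exp (-(lowerIndex A * h)) * ‖x‖ := by
  have h1 := exp_mul_norm_le_norm_exp ((h : ℂ) • A) (lowerIndex A * h) (fun u hu l hl => by
    have := lowerIndex_le (A := A) ⟨u, hu, l, hl, rfl⟩
    rw [smul_apply, map_smul, smul_eq_mul, Complex.re_ofReal_mul, mul_comm]
    gcongr) (NormedSpace.exp (((-h : ℝ) : ℂ) • A) x)
  have h2 : NormedSpace.exp ((h : ℂ) • A) (NormedSpace.exp (((-h : ℝ) : ℂ) • A) x) = x := by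
    let _ : NormedAlgebra ℚ (X →L[ℂ] X) := .restrictScalars ℚ ℂ _
    rw [← mul_apply_eq_comp, ← NormedSpace.exp_add_of_commute
      (((Commute.refl A).smul_left _).smul_right _), ← add_smul]
    simp
  rw [h2] at h1
  rw [Real.exp_neg, ← div_eq_inv_mul, le_div_iff₀ (Real.exp_pos _), mul_comm]
  exact h1

theorem le_norm_exp_neg_smul [CompleteSpace X] (A : X →L[ℂ] X) {h : ℝ} (hh : 0 ≤ h) (x : X) :
    Real.exp (-(upperIndex A * h)) * ‖x‖ ≤ ‖NormedSpace.exp (((-h : ℝ) : ℂ) • A) x‖ := by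
  refine exp_mul_norm_le_norm_exp _ _ (fun u hu l hl => ?_) x
  have := le_upperIndex (A := A) ⟨u, hu, l, hl, rfl⟩
  rw [smul_apply, map_smul, smul_eq_mul, Complex.re_ofReal_mul]
  nlinarith

/-! ### From one step to the whole evolution family. -/

/-- An exponential decay estimate for an evolution family follows from its infinitesimal version
with a quadratic error term. -/
theorem SemigroupProperty.le_exp_mul {v : X → ℝ → ℝ → X}
    (hSchwarz : ∀ s t : ℝ, 0 ≤ s → s ≤ t → IsSchwarzMapping (fun z => v z s t))
    (hsemi : SemigroupProperty v) {z : X} (hz : z ∈ ball (0 : X) 1) {φ : X → ℝ} {μ C : ℝ}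
    (hμ : 0 ≤ μ) (hC : 0 ≤ C)
    (hstep : ∀ y : X, ‖y‖ ≤ ‖z‖ → ∀ s t : ℝ, 0 ≤ s → s ≤ t →
      φ (v y s t) ≤ Real.exp (-(μ * (t - s))) * φ y + C * (t - s) ^ 2)
    {s t : ℝ} (hs : 0 ≤ s) (hst : s ≤ t) :
    φ (v z s t) ≤ Real.exp (-(μ * (t - s))) * φ z := by
  have hbound : ∀ n : ℕ, 0 < n →
      φ (v z s t) ≤ Real.exp (-(μ * (t - s))) * φ z + C * (t - s) ^ 2 / n := by
    intro n hn
    have hn' : (0 : ℝ) < n := by exact_mod_cast hn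
    set h : ℝ := (t - s) / n with hh
    have hh0 : 0 ≤ h := div_nonneg (sub_nonneg.2 hst) hn'.le
    have hind : ∀ i : ℕ,
        φ (v z s (s + i * h)) ≤ Real.exp (-(μ * (i * h))) * φ z + i * (C * h ^ 2) := by
      intro i
      induction i with
      | zero => simpa using hstep z le_rfl s s hs le_rfl
      | succ i ih =>
        have h1 : s ≤ s + i * h := le_add_of_nonneg_right (by positivity)
        have h2 : s + i * h ≤ s + (i + 1 : ℕ) * h := by push_cast; nlinarith
        have h3 := hstep (v z s (s + i * h)) ((hSchwarz s _ hs h1).norm_le hz) _ _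
          (hs.trans h1) h2
        rw [hsemi z hz s _ _ hs h1 h2] at h3
        have e : s + ((i + 1 : ℕ) : ℝ) * h - (s + i * h) = h := by push_cast; ring
        rw [e] at h3
        have e2 : Real.exp (-(μ * (((i + 1 : ℕ) : ℝ) * h)))
            = Real.exp (-(μ * h)) * Real.exp (-(μ * (i * h))) := by
          rw [← Real.exp_add]; push_cast; ring_nf
        -- Errors made earlier are not amplified; this is where `0 ≤ μ` enters.
        have h4 : Real.exp (-(μ * h)) ≤ 1 := Real.exp_le_one_iff.2 (by
          have := mul_nonneg hμ hh0; linarith)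
        have h5 : 0 ≤ i * (C * h ^ 2) := by positivity
        rw [e2]
        push_cast at h3 ⊢
        nlinarith [mul_le_mul_of_nonneg_left ih (Real.exp_pos (-(μ * h))).le]
    have := hind n
    have e : (n : ℝ) * h = t - s := by rw [hh]; field_simp
    rw [e, add_sub_cancel] at this
    refine this.trans_eq ?_
    rw [hh]
    field_simp
  have hlim : Tendsto (fun n : ℕ => Real.exp (-(μ * (t - s))) * φ z + C * (t - s) ^ 2 / n) atTop
      (𝓝 (Real.exp (-(μ * (t - s))) * φ z + 0)) :=
    (tendsto_const_div_atTop_nhds_zero_nat _).const_add _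
  rw [add_zero] at hlim
  refine ge_of_tendsto hlim ?_
  filter_upwards [eventually_gt_atTop 0] with n hn using hbound n hn

/-- The error term of one step is quadratic in the length of the step. -/
theorem one_sub_exp_sq_div_le {r R μ h : ℝ} (hr : 0 ≤ r) (hrR : r ≤ R) (hR : R < 1)
    (hμ : 0 ≤ μ) (hh : 0 ≤ h) :
    (r * (1 - Real.exp (-(μ * h)))) ^ 2 / (1 - r ^ 2) ^ 2 ≤ μ ^ 2 / (1 - R ^ 2) ^ 2 * h ^ 2 := by
  have h0 : 0 ≤ μ * h := mul_nonneg hμ hh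
  have h1 : 0 ≤ 1 - Real.exp (-(μ * h)) := sub_nonneg.2 (Real.exp_le_one_iff.2 (by linarith))
  have h2 : 1 - Real.exp (-(μ * h)) ≤ μ * h := by linarith [Real.add_one_le_exp (-(μ * h))]
  have h3 : 0 < 1 - R ^ 2 := by nlinarith
  have h4 : r ≤ 1 := hrR.trans hR.le
  calc (r * (1 - Real.exp (-(μ * h)))) ^ 2 / (1 - r ^ 2) ^ 2
      ≤ (1 * (μ * h)) ^ 2 / (1 - R ^ 2) ^ 2 := by gcongr
    _ = _ := by ring

end LoewnerBanach

theorem proposition4p1 {X : Type*} [NormedAddCommGroup X] [NormedSpace ℂ X] [CompleteSpace X]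
    (hX : LoewnerBanach.IsReflexiveSpace X)
    (A : X →L[ℂ] X) (hA : 0 < LoewnerBanach.lowerIndex A)
    (v : X → ℝ → ℝ → X)
    (hSchwarz : ∀ s t : ℝ, 0 ≤ s → s ≤ t →
      LoewnerBanach.IsSchwarzMapping (fun z => v z s t))
    (hsemi : LoewnerBanach.SemigroupProperty v)
    (hne : ∀ z ∈ Metric.ball (0 : X) 1, z ≠ 0 → ∀ s t : ℝ, 0 ≤ s → s ≤ t → v z s t ≠ 0)
    (hderiv : ∀ s t : ℝ, 0 ≤ s → s ≤ t →
      fderiv ℂ (fun z => v z s t) 0 = NormedSpace.exp (((-(t - s) : ℝ) : ℂ) • A)) :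
    ∀ z ∈ Metric.ball (0 : X) 1, ∀ s t : ℝ, 0 ≤ s → s ≤ t →
      ‖v z s t‖ / (1 - ‖v z s t‖) ^ 2
          ≤ Real.exp (-(LoewnerBanach.lowerIndex A * (t - s))) * (‖z‖ / (1 - ‖z‖) ^ 2) ∧
      Real.exp (-(LoewnerBanach.upperIndex A * (t - s))) * (‖z‖ / (1 + ‖z‖) ^ 2)
          ≤ ‖v z s t‖ / (1 + ‖v z s t‖) ^ 2 := by
  intro z hz s t hs hst
  have hzero : ∀ s t : ℝ, 0 ≤ s → s ≤ t → v 0 s t = 0 := fun s t hs hst =>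
    (hSchwarz s t hs hst).map_zero
  rcases eq_or_ne z 0 with rfl | hz0
  · simp [hzero s t hs hst]
  have hz1 : ‖z‖ < 1 := mem_ball_zero_iff.1 hz
  have : Nontrivial X := ⟨z, 0, hz0⟩
  have hk : 0 ≤ LoewnerBanach.upperIndex A := by
    obtain ⟨x, hx⟩ := LoewnerBanach.reNumericalRange_nonempty A
    exact hA.le.trans ((LoewnerBanach.lowerIndex_le hx).trans (LoewnerBanach.le_upperIndex hx))
  constructor
  · refine hsemi.le_exp_mul hSchwarz hz (φ := fun y => ‖y‖ / (1 - ‖y‖) ^ 2)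
      (C := LoewnerBanach.lowerIndex A ^ 2 / (1 - ‖z‖ ^ 2) ^ 2) hA.le (by positivity)
      (fun y hy s t hs hst => ?_) hs hst
    have h0 : 0 ≤ t - s := sub_nonneg.2 hst
    rcases eq_or_ne y 0 with rfl | hy0
    · simp only [hzero s t hs hst, norm_zero, zero_div, mul_zero, zero_add]
      positivity
    have hy1 : ‖y‖ < 1 := hy.trans_lt hz1
    have hyb : y ∈ Metric.ball (0 : X) 1 := mem_ball_zero_iff.2 hy1
    have hw := hSchwarz s t hs hst
    refine (LoewnerBanach.div_one_sub_sq_le (norm_nonneg y) hy1 (Real.exp_pos _).le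
      (norm_nonneg _) (mem_ball_zero_iff.1 (hw.mapsTo hyb)) (hw.norm_mul_le hyb hy0 ?_)).trans
      (add_le_add le_rfl
        (LoewnerBanach.one_sub_exp_sq_div_le (norm_nonneg y) hy hz1 hA.le h0))
    rw [hderiv s t hs hst]
    exact LoewnerBanach.norm_exp_neg_smul_le A h0 y
  -- The sign change turns the lower estimate into an upper one, with decay rate `k(A) ≥ 0`.
  · have := hsemi.le_exp_mul hSchwarz hz (φ := fun y => -(‖y‖ / (1 + ‖y‖) ^ 2))
      (C := LoewnerBanach.upperIndex A ^ 2 / (1 - ‖z‖ ^ 2) ^ 2) hk (by positivity)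
      (fun y hy s t hs hst => ?_) hs hst
    · linarith
    have h0 : 0 ≤ t - s := sub_nonneg.2 hst
    rcases eq_or_ne y 0 with rfl | hy0
    · simp only [hzero s t hs hst, norm_zero, zero_div, mul_zero, zero_add, neg_zero]
      positivity
    have hy1 : ‖y‖ < 1 := hy.trans_lt hz1
    have hyb : y ∈ Metric.ball (0 : X) 1 := mem_ball_zero_iff.2 hy1
    have hw := hSchwarz s t hs hst
    have h1 := LoewnerBanach.le_div_one_add_sq (norm_nonneg y) hy1
      (p := Real.exp (-(LoewnerBanach.upperIndex A * (t - s))))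
      (Real.exp_le_one_iff.2 (by have := mul_nonneg hk h0; linarith))
      (norm_nonneg _) (mem_ball_zero_iff.1 (hw.mapsTo hyb)) (hw.le_norm_mul hyb hy0 (by
        rw [hderiv s t hs hst]
        exact LoewnerBanach.le_norm_exp_neg_smul A h0 y))
    have h2 := LoewnerBanach.one_sub_exp_sq_div_le (norm_nonneg y) hy hz1 hk h0
    linarith
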